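/- Let $X$ be a (real or complex) Banach space with a long sub-symmetric basis, that is, with an unconditional Schauder basis $(e_\gamma)_{\gamma\in I}$ indexed by a well-ordered set $I$ such that for any two strictly increasing sequences $(\gamma_n)_{n\in\mathbb N}$ and $(\delta_n)_{n\in\mathbb N}$ in $I$ the sequences $(e_{\gamma_n})$ and $(e_{\delta_n})$ are equivalent (for all scalars $(a_n)$, the series $\sum_n a_ne_{\gamma_n}$ converges if and only if $\sum_n a_ne_{\delta_n}$ converges). Suppose that the density character of $X$, i.e. the least cardinality of a dense subset of $X$, is at least $\omega_\omega$. Suppose further that for some set $\Gamma$ there is a map $f\colon X\to c_0(\Gamma)$ that is - a coarse embedding, i.e. for every $d>0$ there is $K\ge0$ such that $\|f(x)-f(y)\|\le K$ whenever $\|x-y\|\le d$, and for every $K>0$ there is $d>0$ such that $\|f(x)-f(y)\|\ge K$ whenever $\|x-y\|\ge d$; or - a uniform embedding, i.e. $f$ is one-to-one and both $f$ and $f^{-1}\colon f(X)\to X$ are uniformly continuous. Then there is a set $\Lambda$ such that $X$ is linearly isomorphic (by a linear homeomorphism) to $c_0(\Lambda)$. -/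

import Mathlib

open Filter Topology
open scoped Cardinal ZeroAtInfty

universe u

/-- The density character of a topological space: the least cardinality of a dense subset. -/
noncomputable def dens (X : Type*) [TopologicalSpace X] : Cardinal :=
  sInf {c : Cardinal | ∃ D : Set X, Dense D ∧ #D = c}

section Coarse

variable {X Y : Type*} [MetricSpace X] [MetricSpace Y]

/-- `f` is of bounded expansion. -/
def IsBoundedExpansion (f : X → Y) : Prop :=
  ∀ d : ℝ, 0 < d → ∃ K : ℝ, 0 ≤ K ∧ ∀ x y : X, dist x y ≤ d → dist (f x) (f y) ≤ K

/-- `f` is of bounded compression. -/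
def IsBoundedCompression (f : X → Y) : Prop :=
  ∀ K : ℝ, 0 < K → ∃ d : ℝ, 0 < d ∧ ∀ x y : X, d ≤ dist x y → K ≤ dist (f x) (f y)

/-- A coarse embedding (not necessarily injective or continuous). -/
def IsCoarseEmbedding (f : X → Y) : Prop :=
  IsBoundedExpansion f ∧ IsBoundedCompression f

end Coarse

section Subsymmetric

variable {X : Type*} [NormedAddCommGroup X]

/-- The series `∑ u n` converges, in the sense that its sequence of partial sums does. -/
def SeriesConverges (u : ℕ → X) : Prop :=
  ∃ s : X, Tendsto (fun n : ℕ => ∑ i ∈ Finset.range n, u i) atTop (𝓝 s)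

/-- Two (basic) sequences `x` and `y` are equivalent: for every sequence of scalars `a`, the series
`∑ a n • x n` converges if and only if the series `∑ a n • y n` does. -/
def EquivalentSequences (𝕜 : Type*) [NontriviallyNormedField 𝕜] [NormedSpace 𝕜 X]
    (x y : ℕ → X) : Prop :=
  ∀ a : ℕ → 𝕜, SeriesConverges (fun n => a n • x n) ↔ SeriesConverges (fun n => a n • y n)

/-- A (long) unconditional basis, indexed by a well-ordered set, is sub-symmetric if any two
sequences of its members taken along strictly increasing sequences of indices are equivalent. -/
def IsSubsymmetric {ι 𝕜 : Type*} [LinearOrder ι] [WellFoundedLT ι] [NontriviallyNormedField 𝕜]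
    [NormedSpace 𝕜 X] (e : UnconditionalSchauderBasis ι 𝕜 X) : Prop :=
  ∀ s t : ℕ → ι, StrictMono s → StrictMono t →
    EquivalentSequences 𝕜 (fun n => e (s n)) (fun n => e (t n))

end Subsymmetric

/-! Rounding the coordinates of `f` colours `X` so that balls of some radius `r` see finitely many
colours and colour classes have diameter at most `D` (`exists_colouring`). Since the basis has at
least `ℵ_ω` members, pigeonholing through the first `n` steps of the aleph scale gives disjoint sets
`A`, `B`, `A` of size `n`, whose sums of scaled basis vectors share a colour
(`exists_disjoint_sum_same_color`). Projecting the difference onto `A` bounds `‖∑ i ∈ A, e i‖`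
independently of `n`. Such sets `A` can be found successively with any prescribed sizes.
Sub-symmetry carries the bound to all finite sets (`IsSubsymmetric.exists_norm_sum_le`), and a
seminormalized unconditional basis with bounded finite sums is the `c₀` basis. -/

/-! ### Infinite pigeonhole along the alephs. -/

theorem aleph_lt_mk_Ico {ι : Type u} [LinearOrder ι] {β : ℕ → ι}
    (hβ : ∀ k, #(Set.Iio (β k)) = ℵ_ (k : Ordinal)) (k : ℕ) :
    ℵ_ (k : Ordinal) < #(Set.Ico (β k) (β (k + 1))) := by
  by_contra! h
  have h1 : Set.Iio (β (k + 1)) ⊆ Set.Iio (β k) ∪ Set.Ico (β k) (β (k + 1)) := by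
    intro x hx
    rcases lt_or_ge x (β k) with h | h
    · exact Or.inl h
    · exact Or.inr ⟨h, hx⟩
  have h2 := (Cardinal.mk_le_mk_of_subset h1).trans (Cardinal.mk_union_le _ _)
  rw [hβ, hβ] at h2
  have h3 : ℵ_ (k : Ordinal) + #(Set.Ico (β k) (β (k + 1))) ≤ ℵ_ (k : Ordinal) :=
    (add_le_add_right h _).trans (Cardinal.add_eq_self (Cardinal.aleph0_le_aleph _)).le
  have h4 : ℵ_ (k : Ordinal) < ℵ_ ((k + 1 : ℕ) : Ordinal) := by
    rw [Cardinal.aleph_lt_aleph]; exact_mod_cast Nat.lt_succ_self k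
  exact absurd (h2.trans h3) (not_le.2 h4)

/-- If a colouring has only finitely many colours on each ball of radius `r`, then some two disjoint
`n`-fold sums of members of a long family of diameter at most `r` have the same colour. -/
theorem exists_disjoint_sum_same_color {ι : Type u} [LinearOrder ι] {X C : Type*}
    [SeminormedAddCommGroup X] {u : ι → X} {r : ℝ} (hu : ∀ a b, ‖u a - u b‖ ≤ r) {β : ℕ → ι}
    (hmono : StrictMono β) (hβ : ∀ k, #(Set.Iio (β k)) = ℵ_ (k : Ordinal)) (m n : ℕ)
    (c : X → C) (hc : ∀ x, (c '' Metric.closedBall x r).Finite) :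
    ∃ A B : Finset ι, (∀ a ∈ A, a ∈ Set.Ico (β m) (β (m + n))) ∧
      (∀ b ∈ B, b ∈ Set.Ico (β m) (β (m + n))) ∧ A.card = n ∧ Disjoint A B ∧
      c (∑ a ∈ A, u a) = c (∑ b ∈ B, u b) := by
  classical
  induction n generalizing c with
  | zero => exact ⟨∅, ∅, by simp⟩
  | succ n ih =>
    set b := β (m + n) with hb
    -- The induction hypothesis is applied to the colouring translated by `u a`. Pairs of finite
    -- subsets of `Iio b` number only `ℵ_(m + n)`, fewer than the `a` in the next block, so one pair
    -- serves infinitely many `a`.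
    have key : ∀ a : ι, ∃ P : Finset (Set.Iio b) × Finset (Set.Iio b),
        (∀ x ∈ P.1, β m ≤ x) ∧ (∀ x ∈ P.2, β m ≤ x) ∧ P.1.card = n ∧ Disjoint P.1 P.2 ∧
        c (∑ x ∈ P.1, u x + u a) = c (∑ x ∈ P.2, u x + u a) := by
      intro a
      obtain ⟨A, B, hA, hB, hn, hd, h⟩ := ih (fun x => c (x + u a)) (fun x => by
        refine (hc (x + u a)).subset ?_
        rintro _ ⟨y, hy, rfl⟩
        refine ⟨y + u a, ?_, rfl⟩
        simpa [dist_eq_norm] using hy)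
      have hA' : (A.subtype (· ∈ Set.Iio b)).map (Function.Embedding.subtype _) = A :=
        Finset.subtype_map_of_mem fun x hx => (hA x hx).2
      have hB' : (B.subtype (· ∈ Set.Iio b)).map (Function.Embedding.subtype _) = B :=
        Finset.subtype_map_of_mem fun x hx => (hB x hx).2
      refine ⟨(A.subtype _, B.subtype _), fun x hx => (hA x (by simpa using hx)).1,
        fun x hx => (hB x (by simpa using hx)).1, ?_, ?_, ?_⟩
      · rw [← hn, ← Finset.card_map (Function.Embedding.subtype _), hA']
      · rw [← Finset.disjoint_map (Function.Embedding.subtype _), hA', hB']; exact hd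
      · have e1 : ∑ x ∈ A.subtype (· ∈ Set.Iio b), u x = ∑ x ∈ A, u x := by
          conv_rhs => rw [← hA', Finset.sum_map]
          rfl
        have e2 : ∑ x ∈ B.subtype (· ∈ Set.Iio b), u x = ∑ x ∈ B, u x := by
          conv_rhs => rw [← hB', Finset.sum_map]
          rfl
        simp only [e1, e2]
        exact h
    choose P hP1 hP2 hPn hPd hPc using key
    let J := Set.Ico b (β (m + n + 1))
    have hJ : ℵ_ ((m + n : ℕ) : Ordinal) < #J := aleph_lt_mk_Ico hβ (m + n)
    have hinf : Infinite (Set.Iio b) := by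
      rw [Cardinal.infinite_iff, hβ]; exact Cardinal.aleph0_le_aleph _
    have hJinf : Infinite J := by
      rw [Cardinal.infinite_iff]; exact (Cardinal.aleph0_le_aleph _).trans hJ.le
    obtain ⟨⟨A, B⟩, hAB⟩ := Cardinal.exists_infinite_fiber (fun a : J => P a) (by
      rw [← Cardinal.mul_def, Cardinal.mk_finset_of_infinite,
        hβ, Cardinal.mul_eq_self (Cardinal.aleph0_le_aleph _)]
      exact hJ)
    rw [Set.infinite_coe_iff] at hAB
    obtain ⟨a₀, -⟩ := hAB.nonempty
    -- For fixed `A` these sums lie in one ball of radius `r`, so two distinct `a`, `a'` agree in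
    -- colour. Then `A ∪ {a}`, `A ∪ {a'}` and `B ∪ {a'}` have the same colour, and the first and
    -- last are disjoint.
    obtain ⟨a, ha, a', ha', hne, heq⟩ := hAB.exists_ne_map_eq_of_mapsTo
      (f := fun a : J => c (∑ x ∈ A, u x + u a)) (t := c '' Metric.closedBall (∑ x ∈ A, u x + u a₀) r)
      (fun a _ => ⟨_, by simpa [dist_eq_norm] using hu a a₀, rfl⟩) (hc _)
    have ha : P a = (A, B) := ha
    have ha' : P a' = (A, B) := ha'
    have hlt : b < β (m + n + 1) := hmono (Nat.lt_succ_self _)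
    have hmb : β m ≤ b := hmono.monotone (Nat.le_add_right _ _)
    have aux : ∀ (S : Finset (Set.Iio b)) (z : J), (∀ x ∈ S, β m ≤ x) →
        (z : ι) ∉ S.map (Function.Embedding.subtype _) ∧
        ∀ x ∈ insert (z : ι) (S.map (Function.Embedding.subtype _)),
          x ∈ Set.Ico (β m) (β (m + (n + 1))) := by
      intro S z hS
      constructor
      · simp only [Finset.mem_map, not_exists, not_and]
        rintro ⟨x, hx⟩ - h
        exact absurd (h ▸ hx : (z : ι) < b) (not_lt.2 z.2.1)
      · intro x hx
        rcases Finset.mem_insert.1 hx with rfl | hx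
        · exact ⟨hmb.trans z.2.1, z.2.2⟩
        · obtain ⟨y, hy, rfl⟩ := Finset.mem_map.1 hx
          exact ⟨hS y hy, lt_trans y.2 hlt⟩
    have hA := aux A a (by simpa [ha] using hP1 a)
    have hB := aux B a' (by simpa [ha'] using hP2 a')
    have hA' := aux A a' (by simpa [ha] using hP1 a)
    have hB' := aux B a (by simpa [ha'] using hP2 a')
    refine ⟨insert (a : ι) (A.map (Function.Embedding.subtype _)),
      insert (a' : ι) (B.map (Function.Embedding.subtype _)), hA.2, hB.2, ?_, ?_, ?_⟩
    · rw [Finset.card_insert_of_notMem hA.1, Finset.card_map]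
      simpa [ha] using hPn a
    · rw [Finset.disjoint_insert_left, Finset.disjoint_insert_right, Finset.disjoint_map]
      refine ⟨?_, hA'.1, by simpa [ha] using hPd a⟩
      rw [Finset.mem_insert, not_or]
      exact ⟨fun h => hne (Subtype.ext h), hB'.1⟩
    · rw [Finset.sum_insert hA.1, Finset.sum_insert hB.1, Finset.sum_map, Finset.sum_map,
        add_comm, add_comm (u a')]
      refine heq.trans ?_
      simpa [ha'] using hPc a'

/-- A well-order of cardinality at least `ℵ_ω` has initial segments of cardinality `ℵ_k`. -/
theorem exists_strictMono_mk_Iio_eq_aleph {ι : Type u} [LinearOrder ι] [WellFoundedLT ι]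
    (h : ℵ_ Ordinal.omega0 ≤ #ι) :
    ∃ β : ℕ → ι, StrictMono β ∧ ∀ k, #(Set.Iio (β k)) = ℵ_ (k : Ordinal) := by
  have hlt : ∀ k : ℕ, (ℵ_ (k : Ordinal)).ord < Ordinal.type ((· < ·) : ι → ι → Prop) := by
    intro k
    refine lt_of_lt_of_le (Cardinal.ord_lt_ord.2 ?_) (Cardinal.ord_le_type ((· < ·) : ι → ι → Prop))
    refine lt_of_lt_of_le ?_ h
    rw [Cardinal.aleph_lt_aleph]
    exact Ordinal.natCast_lt_omega0 k
  refine ⟨fun k => Ordinal.enum (· < ·) ⟨_, hlt k⟩, ?_, ?_⟩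
  · intro k l hkl
    refine (Ordinal.enum (α := ι) (· < ·)).map_rel_iff.2 ?_
    change (ℵ_ (k : Ordinal)).ord < (ℵ_ (l : Ordinal)).ord
    rw [Cardinal.ord_lt_ord, Cardinal.aleph_lt_aleph]
    exact_mod_cast hkl
  · intro k
    have := Ordinal.card_typein (r := ((· < ·) : ι → ι → Prop))
      (Ordinal.enum (· < ·) ⟨_, hlt k⟩)
    rw [Ordinal.typein_enum, Cardinal.card_ord] at this
    exact this.symm

/-! ### Successive finite sets in a well-order. -/

/-- The intervals between consecutive values of `p` partition `ℕ`; `J` later serves as the exponent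
of coefficients constant on each block. -/
theorem strictMono_exists_block {p : ℕ → ℕ} (hp : StrictMono p) (h0 : p 0 = 0) :
    ∃ J : ℕ → ℕ, ∀ i j, i ∈ Finset.Ico (p j) (p (j + 1)) ↔ J i = j := by
  have hex : ∀ i, ∃ j, i < p (j + 1) := fun i => ⟨i, (Nat.lt_succ_self i).trans_le (hp.le_apply)⟩
  refine ⟨fun i => Nat.find (hex i), fun i j => ?_⟩
  rw [Nat.find_eq_iff, Finset.mem_Ico]
  constructor
  · rintro ⟨h1, h2⟩
    exact ⟨h2, fun k hk => not_lt.2 ((hp.monotone hk).trans h1)⟩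
  · rintro ⟨h1, h2⟩
    refine ⟨?_, h1⟩
    cases j with
    | zero => simp [h0]
    | succ j => exact not_lt.1 (h2 j (Nat.lt_succ_self j))

/-- Successive finite sets of a linear order are enumerated by a strictly increasing sequence. -/
theorem exists_strictMono_map_Ico_eq {ι : Type*} [LinearOrder ι] {B : ℕ → Finset ι} {p : ℕ → ℕ}
    (hB : ∀ j, (B j).Nonempty) (hlt : ∀ j, ∀ a ∈ B j, ∀ b ∈ B (j + 1), a < b)
    (h0 : p 0 = 0) (hp : ∀ j, p (j + 1) = p j + (B j).card) :
    ∃ t : ℕ → ι, StrictMono t ∧ ∀ j, (Finset.Ico (p j) (p (j + 1))).image t = B j := by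
  have hpm : StrictMono p := strictMono_nat_of_lt_succ fun j => by
    rw [hp]; exact Nat.lt_add_of_pos_right (hB j).card_pos
  obtain ⟨J, hJ⟩ := strictMono_exists_block hpm h0
  have hi : ∀ i, p (J i) ≤ i ∧ i < p (J i) + (B (J i)).card := fun i => by
    rw [← hp]; exact Finset.mem_Ico.1 ((hJ i (J i)).2 rfl)
  let t : ℕ → ι := fun i =>
    (B (J i)).orderEmbOfFin rfl ⟨i - p (J i), by have := hi i; omega⟩
  have ht : ∀ j (k : ℕ) (hk : k < (B j).card), t (p j + k) = (B j).orderEmbOfFin rfl ⟨k, hk⟩ := by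
    intro j k hk
    have h : J (p j + k) = j := (hJ _ _).1 (by rw [Finset.mem_Ico, hp]; omega)
    have : ∀ j' (h : j' = j) (hlt : p j + k - p j' < (B j').card),
        (B j').orderEmbOfFin rfl ⟨p j + k - p j', hlt⟩ = (B j).orderEmbOfFin rfl ⟨k, hk⟩ := by
      rintro _ rfl _
      congr 2
      omega
    exact this _ h _
  have hmem : ∀ i, t i ∈ B (J i) := fun i => Finset.orderEmbOfFin_mem _ _ _
  refine ⟨t, strictMono_nat_of_lt_succ fun i => ?_, fun j => ?_⟩
  · by_cases h : i + 1 < p (J i) + (B (J i)).card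
    · obtain ⟨k, hk⟩ := Nat.exists_eq_add_of_le (hi i).1
      rw [show i + 1 = p (J i) + (k + 1) by omega, ht _ _ (by omega)]
      conv_lhs => rw [hk, ht _ _ (by omega)]
      exact (OrderEmbedding.lt_iff_lt _).2 (by simp)
    · have h1 : i + 1 = p (J i + 1) := by have := hi i; rw [hp]; omega
      have h2 : J (i + 1) = J i + 1 := (hJ _ _).1 (by
        rw [Finset.mem_Ico, h1]; exact ⟨le_rfl, hpm (Nat.lt_succ_self _)⟩)
      exact hlt (J i) _ (hmem i) _ (h2 ▸ hmem (i + 1))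
  · ext b
    rw [Finset.mem_image]
    constructor
    · rintro ⟨i, hi, rfl⟩
      exact (hJ i j).1 hi ▸ hmem i
    · intro hb
      obtain ⟨⟨k, hk⟩, rfl⟩ : b ∈ Set.range ((B j).orderEmbOfFin rfl) := by
        rw [Finset.range_orderEmbOfFin]; exact hb
      exact ⟨p j + k, by rw [Finset.mem_Ico, hp]; omega, ht j k hk⟩

/-- If the finite sums of a bounded well-ordered family are unbounded, then their norms grow
arbitrarily fast along some successive finite sets. -/
theorem exists_successive_finsets {ι X : Type*} [LinearOrder ι] [WellFoundedLT ι]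
    [SeminormedAddCommGroup X] {u : ι → X} {M : ℝ} (hM : ∀ i, ‖u i‖ ≤ M)
    (h : ∀ R : ℝ, ∃ A : Finset ι, R < ‖∑ i ∈ A, u i‖) (R : ℕ → ℝ) :
    ∃ B : ℕ → Finset ι, (∀ j, ∀ a ∈ B j, ∀ b ∈ B (j + 1), a < b) ∧
      ∀ j, R j < ‖∑ i ∈ B j, u i‖ := by
  classical
  let Unb : Set ι → Prop := fun T => ∀ R : ℝ, ∃ A : Finset ι, ↑A ⊆ T ∧ R < ‖∑ i ∈ A, u i‖
  -- `T` is the shortest initial segment with unbounded sums, so discarding everything up to some `b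
  -- ∈ T` leaves the sums unbounded.
  obtain ⟨T, hT, hmin⟩ : ∃ T : Set ι, Unb T ∧ ∀ b ∈ T, ¬ Unb (Set.Iio b) := by
    by_cases hex : ∃ a, Unb (Set.Iio a)
    · obtain ⟨a, ha, hmin⟩ := wellFounded_lt.has_min {a : ι | Unb (Set.Iio a)} hex
      exact ⟨Set.Iio a, ha, fun b hb hU => hmin b hU hb⟩
    · push Not at hex
      exact ⟨Set.univ, fun R => by simpa using h R, fun b _ => hex b⟩
  have step : ∀ b ∈ T, ∀ R : ℝ, ∃ A : Finset ι, ↑A ⊆ T ∧ (∀ a ∈ A, b < a) ∧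
      R < ‖∑ i ∈ A, u i‖ := by
    intro b hb R
    have hb' := hmin b hb
    simp only [Unb, not_forall, not_exists, not_and, not_lt] at hb'
    obtain ⟨K, hK⟩ := hb'
    -- The discarded part costs at most `K` below `b` and `M` at `b` itself.
    obtain ⟨A, hA, hAR⟩ := hT (R + (K + M))
    refine ⟨A.filter (b < ·), fun x hx => hA (Finset.mem_filter.1 hx).1,
      fun a ha => (Finset.mem_filter.1 ha).2, ?_⟩
    have h1 : ‖∑ i ∈ A.filter (¬ b < ·), u i‖ ≤ K + M := by
      have hsub : ((A.filter (¬ b < ·)).erase b : Set ι) ⊆ Set.Iio b := by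
        intro x hx
        have := Finset.mem_erase.1 hx
        exact lt_of_le_of_ne (not_lt.1 (Finset.mem_filter.1 this.2).2) this.1
      by_cases hbA : b ∈ A.filter (¬ b < ·)
      · rw [← Finset.sum_erase_add _ _ hbA]
        exact (norm_add_le _ _).trans (add_le_add (hK _ (by exact_mod_cast hsub)) (hM b))
      · rw [← Finset.erase_eq_of_notMem hbA]
        exact (hK _ (by exact_mod_cast hsub)).trans
          (le_add_of_nonneg_right ((norm_nonneg _).trans (hM b)))
    rw [← Finset.sum_filter_add_sum_filter_not A (b < ·)] at hAR
    linarith [norm_add_le (∑ i ∈ A.filter (b < ·), u i) (∑ i ∈ A.filter (¬ b < ·), u i)]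
  have step' : ∀ (A : {A : Finset ι // ↑A ⊆ T}) (R : ℝ), ∃ A' : {A : Finset ι // ↑A ⊆ T},
      (∀ a ∈ A.1, ∀ b ∈ A'.1, a < b) ∧ R < ‖∑ i ∈ A'.1, u i‖ := by
    rintro ⟨A, hA⟩ R
    by_cases hne : A.Nonempty
    · obtain ⟨A', h1, h2, h3⟩ := step (A.max' hne) (hA (A.max'_mem hne)) R
      exact ⟨⟨A', h1⟩, fun a ha b hb => (A.le_max' a ha).trans_lt (h2 b hb), h3⟩
    · obtain ⟨A', h1, h2⟩ := hT R
      exact ⟨⟨A', h1⟩, fun a ha => absurd ⟨a, ha⟩ hne, h2⟩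
  choose next hn1 hn2 using step'
  let B : ℕ → {A : Finset ι // ↑A ⊆ T} := fun j =>
    Nat.rec (next ⟨∅, by simp⟩ (R 0)) (fun j A => next A (R (j + 1))) j
  exact ⟨fun j => (B j).1, fun j => hn1 (B j) (R (j + 1)),
    fun j => by cases j <;> exact hn2 _ _⟩

/-! ### Colouring by rounding in `c₀`. -/

theorem norm_le_abs_re_add_abs_im {𝕜 : Type*} [RCLike 𝕜] (z : 𝕜) :
    ‖z‖ ≤ |RCLike.re z| + |RCLike.im z| := by
  conv_lhs => rw [← RCLike.re_add_im z]
  refine (norm_add_le _ _).trans (add_le_add (by simp) ?_)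
  rw [norm_mul, RCLike.norm_ofReal]
  exact mul_le_of_le_one_right (abs_nonneg _) (by
    rcases eq_or_ne (RCLike.I : 𝕜) 0 with h | h
    · simp [h]
    · exact (RCLike.norm_I_of_ne_zero h).le)

section Colouring

variable {𝕜 Γ : Type*} [RCLike 𝕜] [TopologicalSpace Γ]

theorem ZeroAtInftyContinuousMap.norm_apply_le (x : C₀(Γ, 𝕜)) (g : Γ) : ‖x g‖ ≤ ‖x‖ :=
  x.toBCF.norm_coe_le_norm g

theorem ZeroAtInftyContinuousMap.norm_le_of_forall {x : C₀(Γ, 𝕜)} {C : ℝ} (hC : 0 ≤ C)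
    (h : ∀ g, ‖x g‖ ≤ C) : ‖x‖ ≤ C :=
  (BoundedContinuousFunction.norm_le hC (f := x.toBCF)).2 h

theorem ZeroAtInftyContinuousMap.finite_le_norm [DiscreteTopology Γ] (x : C₀(Γ, 𝕜)) {ε : ℝ} (hε : 0 < ε) :
    {g | ε ≤ ‖x g‖}.Finite := by
  have h := x.zero_at_infty'
  rw [Filter.cocompact_eq_cofinite] at h
  have := (h.norm).eventually (gt_mem_nhds (by simpa using hε))
  simpa [Filter.eventually_cofinite] using this

/-- The coordinatewise rounding of an element of `c₀(Γ)` to the lattice of mesh `s`. -/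
noncomputable def latticeRound (s : ℝ) (x : C₀(Γ, 𝕜)) (g : Γ) : ℤ × ℤ :=
  (round (RCLike.re (x g) / s), round (RCLike.im (x g) / s))

theorem abs_sub_le_of_round_div_eq {s a b : ℝ} (hs : 0 < s) (h : round (a / s) = round (b / s)) :
    |a - b| ≤ s := by
  have h1 := abs_le.1 (abs_sub_round (a / s))
  have h2 := abs_le.1 (abs_sub_round (b / s))
  rw [h] at h1
  have h3 : |a / s - b / s| ≤ 1 := abs_le.2 ⟨by linarith [h1.1, h2.2], by linarith [h1.2, h2.1]⟩
  rw [← sub_div, abs_div, abs_of_pos hs, div_le_one hs] at h3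
  exact h3

theorem dist_le_of_latticeRound_eq {s : ℝ} (hs : 0 < s) {x y : C₀(Γ, 𝕜)}
    (h : latticeRound s x = latticeRound s y) : dist x y ≤ 2 * s := by
  rw [dist_eq_norm]
  refine ZeroAtInftyContinuousMap.norm_le_of_forall (by positivity) fun g => ?_
  have hg := congrFun h g
  rw [latticeRound, latticeRound, Prod.mk.injEq] at hg
  have h1 := abs_sub_le_of_round_div_eq hs hg.1
  have h2 := abs_sub_le_of_round_div_eq hs hg.2
  rw [← map_sub] at h1 h2
  have := norm_le_abs_re_add_abs_im (x g - y g)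
  change ‖x g - y g‖ ≤ _
  linarith

theorem round_div_eq_zero {s a : ℝ} (hs : 0 < s) (h : |a| ≤ s / 3) : round (a / s) = 0 := by
  have h1 : |a / s| ≤ 1 / 3 := by
    rw [abs_div, abs_of_pos hs, div_le_iff₀ hs]; linarith
  have := abs_le.1 h1
  rw [round_eq_zero_iff]
  exact ⟨by linarith, by linarith⟩

theorem round_div_mem_Icc {s a R : ℝ} (hs : 0 < s) (h : |a| ≤ R) :
    round (a / s) ∈ Set.Icc (-⌈R / s + 1⌉) ⌈R / s + 1⌉ := by
  have h0 : |a / s| ≤ R / s := by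
    rw [abs_div, abs_of_pos hs]; gcongr
  have h1 := abs_le.1 h0
  have h2 := abs_le.1 (abs_sub_round (a / s))
  have h3 := Int.le_ceil (R / s + 1)
  constructor
  · have : ((-⌈R / s + 1⌉ : ℤ) : ℝ) ≤ round (a / s) := by push_cast; linarith [h1.1, h2.2]
    exact_mod_cast this
  · have : (round (a / s) : ℝ) ≤ ⌈R / s + 1⌉ := by linarith [h1.2, h2.1]
    exact_mod_cast this

/-- Off the finite set where `‖x g‖ ≥ s / 6`, every point of the ball has modulus at most `s / 3`
and rounds to `0`; on that set the rounded values are bounded integers. -/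
theorem finite_latticeRound_image_closedBall [DiscreteTopology Γ] {s : ℝ} (hs : 0 < s) (x : C₀(Γ, 𝕜)) :
    (latticeRound s '' Metric.closedBall x (s / 6)).Finite := by
  set G := {g | s / 6 ≤ ‖x g‖} with hG
  have hGfin : G.Finite := x.finite_le_norm (by positivity)
  have : Finite G := hGfin
  set N := ⌈(‖x‖ + s / 6) / s + 1⌉
  have hzero : ∀ y ∈ Metric.closedBall x (s / 6), ∀ g ∉ G, latticeRound s y g = 0 := by
    intro y hy g hg
    have h1 : ‖y g - x g‖ ≤ s / 6 :=
      ((y - x).norm_apply_le g).trans (by simpa [dist_eq_norm] using hy)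
    have h2 : ‖x g‖ < s / 6 := not_le.1 hg
    have h3 : ‖y g‖ ≤ s / 3 := by linarith [norm_le_norm_add_norm_sub' (y g) (x g)]
    rw [latticeRound, round_div_eq_zero hs ((RCLike.abs_re_le_norm _).trans h3),
      round_div_eq_zero hs ((RCLike.abs_im_le_norm _).trans h3)]
    rfl
  refine Set.Finite.of_finite_image (f := fun z (g : G) => z g) ?_ ?_
  · refine (Set.Finite.pi' (t := fun _ : G => Set.Icc (-N) N ×ˢ Set.Icc (-N) N)
      fun _ => (Set.finite_Icc _ _).prod (Set.finite_Icc _ _)).subset ?_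
    rintro _ ⟨_, ⟨y, hy, rfl⟩, rfl⟩ g
    have h1 : ‖y g‖ ≤ ‖x‖ + s / 6 := by
      have h2 : ‖y - x‖ ≤ s / 6 := by simpa [dist_eq_norm] using hy
      linarith [y.norm_apply_le g, norm_le_norm_add_norm_sub' y x]
    exact ⟨round_div_mem_Icc hs ((RCLike.abs_re_le_norm _).trans h1),
      round_div_mem_Icc hs ((RCLike.abs_im_le_norm _).trans h1)⟩
  · rintro _ ⟨y, hy, rfl⟩ _ ⟨y', hy', rfl⟩ h
    funext g
    by_cases hg : g ∈ G
    · exact congrFun h ⟨g, hg⟩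
    · rw [hzero y hy g hg, hzero y' hy' g hg]

/-- A coarse or uniform embedding into `c₀(Γ)` provides a colouring of its domain which is finite
on the balls of some radius, and whose colour classes are uniformly bounded. -/
theorem exists_colouring [DiscreteTopology Γ] {X : Type*} [MetricSpace X] {f : X → C₀(Γ, 𝕜)}
    (hf : IsCoarseEmbedding f ∨ IsUniformEmbedding f) :
    ∃ (c : X → Γ → ℤ × ℤ) (r D : ℝ), 0 < r ∧ 0 < D ∧
      (∀ x, (c '' Metric.closedBall x r).Finite) ∧ ∀ x y, c x = c y → dist x y ≤ D := by
  obtain ⟨r, s, D, hr, hs, hD, h1, h2⟩ : ∃ r s D : ℝ, 0 < r ∧ 0 < s ∧ 0 < D ∧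
      (∀ x y, dist x y ≤ r → dist (f x) (f y) ≤ s / 6) ∧
      (∀ x y, dist (f x) (f y) ≤ 2 * s → dist x y ≤ D) := by
    rcases hf with ⟨hexp, hcomp⟩ | hf
    · obtain ⟨K, hK, hK'⟩ := hexp 1 one_pos
      obtain ⟨D, hD, hD'⟩ := hcomp (2 * (6 * K + 1) + 1) (by positivity)
      refine ⟨1, 6 * K + 1, D, one_pos, by positivity, hD, fun x y h => ?_, fun x y h => ?_⟩
      · linarith [hK' x y h]
      · by_contra! hlt
        linarith [hD' x y hlt.le]
    · rw [Metric.isUniformEmbedding_iff] at hf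
      obtain ⟨-, hcont, hinv⟩ := hf
      obtain ⟨δ, hδ, hinv⟩ := hinv 1 one_pos
      obtain ⟨r, hr, hcont⟩ := Metric.uniformContinuous_iff.1 hcont (δ / 3 / 6) (by positivity)
      exact ⟨r / 2, δ / 3, 1, by positivity, by positivity, one_pos,
        fun x y h => (hcont (by linarith)).le, fun x y h => (hinv (by linarith)).le⟩
  refine ⟨fun x => latticeRound s (f x), r, D, hr, hD, fun x => ?_,
    fun x y h => h2 x y (dist_le_of_latticeRound_eq hs h)⟩
  refine (finite_latticeRound_image_closedBall hs (f x)).subset ?_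
  rintro _ ⟨y, hy, rfl⟩
  exact ⟨f y, h1 y x hy, rfl⟩

end Colouring

/-! ### Density character and size of the basis. -/

section Density

theorem HasSum.mem_closure_finset_sums {ι X : Type*} [SeminormedAddCommGroup X] {v : ι → X}
    {x : X} (h : HasSum v x) : x ∈ closure (Set.range fun A : Finset ι => ∑ i ∈ A, v i) :=
  mem_closure_of_tendsto h (Eventually.of_forall fun A => ⟨A, rfl⟩)

/-- If a space with an unconditional basis has density character at least `ℵ_ω`, then its basis
has at least `ℵ_ω` members. -/
theorem aleph_omega_le_mk_of_le_dens {𝕜 X : Type*} [RCLike 𝕜] [NormedAddCommGroup X]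
    [NormedSpace 𝕜 X] {ι : Type u} (e : UnconditionalSchauderBasis ι 𝕜 X)
    (hdens : ℵ_ Ordinal.omega0 ≤ dens X) : ℵ_ Ordinal.omega0 ≤ #ι := by
  classical
  -- Finite combinations with coefficients from a countable dense set are dense, and there are at
  -- most `max #ι ℵ₀` of them.
  let q : ℕ → 𝕜 := TopologicalSpace.denseSeq 𝕜
  let S : (Σ A : Finset ι, (A → ℕ)) → X := fun p => ∑ i : p.1, q (p.2 i) • e i
  have hS : Dense (Set.range S) := by
    intro x
    have h1 := HasSum.mem_closure_finset_sums (e.expansion x)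
    refine closure_minimal ?_ isClosed_closure h1
    rintro _ ⟨A, rfl⟩
    have hcont : Continuous fun a : A → 𝕜 => ∑ i, a i • e i := by fun_prop
    have hd : DenseRange (fun (w : A → ℕ) (i : A) => q (w i)) :=
      DenseRange.piMap fun _ => TopologicalSpace.denseRange_denseSeq 𝕜
    have := hcont.range_subset_closure_image_dense hd ⟨fun i => e.coord i x, rfl⟩
    beta_reduce
    rw [← Finset.sum_coe_sort A fun i => e.coord i x • e i]
    refine closure_mono ?_ this
    rintro _ ⟨_, ⟨w, rfl⟩, rfl⟩
    exact ⟨⟨A, w⟩, rfl⟩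
  have h1 : ℵ_ Ordinal.omega0 ≤ #(Set.range S) := hdens.trans (csInf_le' ⟨_, hS, rfl⟩)
  by_contra! hlt
  have h2 : #(Σ A : Finset ι, (A → ℕ)) ≤ max #ι ℵ₀ := by
    rw [Cardinal.mk_sigma]
    refine (Cardinal.sum_le_mk_mul_iSup _).trans ?_
    have h3 : #(Finset ι) ≤ max #ι ℵ₀ := by
      rcases finite_or_infinite ι with h | h
      · exact (Cardinal.lt_aleph0_of_finite _).le.trans (le_max_right _ _)
      · rw [Cardinal.mk_finset_of_infinite]; exact le_max_left _ _
    have h4 : (⨆ A : Finset ι, #(A → ℕ)) ≤ max #ι ℵ₀ :=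
      ciSup_le' fun A => Cardinal.mk_le_aleph0.trans (le_max_right _ _)
    exact (mul_le_mul' h3 h4).trans (Cardinal.mul_eq_self (le_max_right _ _)).le
  have h3 : max #ι ℵ₀ < ℵ_ Ordinal.omega0 := max_lt hlt (by
    rw [← Cardinal.aleph_zero, Cardinal.aleph_lt_aleph]; exact Ordinal.omega0_pos)
  have h4 := (Cardinal.lift_le.2 h1).trans (Cardinal.mk_range_le_lift (f := S))
  have h5 := Cardinal.lift_lt.2 (h2.trans_lt h3)
  have h6 := h4.trans_lt h5
  rw [Cardinal.lift_aleph, Cardinal.lift_aleph] at h6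
  simp at h6

end Density

/-! ### Unconditional bases and the `c₀` estimate. -/

section Basis

variable {𝕜 X ι : Type*} [RCLike 𝕜] [NormedAddCommGroup X] [NormedSpace 𝕜 X]

theorem UnconditionalSchauderBasis.coord_sum [DecidableEq ι] (e : UnconditionalSchauderBasis ι 𝕜 X)
    (A : Finset ι) (a : ι → 𝕜) (j : ι) :
    e.coord j (∑ i ∈ A, a i • e i) = if j ∈ A then a j else 0 := by
  simp only [map_sum, map_smul, e.ortho, Pi.single_apply, smul_eq_mul, mul_ite, mul_one, mul_zero]
  rw [Finset.sum_ite_eq]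

theorem UnconditionalSchauderBasis.basis_ne_zero (e : UnconditionalSchauderBasis ι 𝕜 X) (i : ι) :
    e i ≠ 0 := e.linearIndependent.ne_zero i

/-- The projection onto `A` kills the sum over `B`. -/
theorem UnconditionalSchauderBasis.norm_sum_le_of_disjoint {e : UnconditionalSchauderBasis ι 𝕜 X}
    {C : ℝ} (hC : ∀ A : Finset ι, ‖e.proj A‖ ≤ C) {A B : Finset ι} (h : Disjoint A B) :
    ‖∑ i ∈ A, e i‖ ≤ C * ‖∑ i ∈ A, e i - ∑ i ∈ B, e i‖ := by
  classical
  have : e.proj A (∑ i ∈ A, e i - ∑ i ∈ B, e i) = ∑ i ∈ A, e i := by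
    rw [map_sub, map_sum, map_sum, Finset.sum_congr rfl fun i hi => by
        rw [e.proj_apply_basis_mem, if_pos hi], Finset.sum_congr (s₁ := B) rfl fun i hi => by
        rw [e.proj_apply_basis_mem, if_neg (Finset.disjoint_right.1 h hi)], Finset.sum_const_zero,
      sub_zero]
  calc ‖∑ i ∈ A, e i‖ = ‖e.proj A (∑ i ∈ A, e i - ∑ i ∈ B, e i)‖ := by rw [this]
    _ ≤ ‖e.proj A‖ * ‖∑ i ∈ A, e i - ∑ i ∈ B, e i‖ := (e.proj A).le_opNorm _
    _ ≤ _ := by gcongr; exact hC A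

theorem sum_abs_le_of_forall_abs_sum_le {x : ι → ℝ} {M : ℝ}
    (h : ∀ A : Finset ι, |∑ i ∈ A, x i| ≤ M) (A : Finset ι) : ∑ i ∈ A, |x i| ≤ 2 * M := by
  rw [← Finset.sum_filter_add_sum_filter_not A (0 ≤ x ·)]
  have h1 : ∑ i ∈ A with 0 ≤ x i, |x i| = ∑ i ∈ A with 0 ≤ x i, x i :=
    Finset.sum_congr rfl fun i hi => abs_of_nonneg (Finset.mem_filter.1 hi).2
  have h2 : ∑ i ∈ A with ¬ 0 ≤ x i, |x i| = -∑ i ∈ A with ¬ 0 ≤ x i, x i := by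
    rw [← Finset.sum_neg_distrib]
    exact Finset.sum_congr rfl fun i hi => abs_of_neg (not_le.1 (Finset.mem_filter.1 hi).2)
  rw [h1, h2]
  have := (abs_le.1 (h (A.filter (0 ≤ x ·)))).2
  have := (abs_le.1 (h (A.filter (¬ 0 ≤ x ·)))).1
  linarith

/-- The factor `4` comes from splitting into real and imaginary parts, then each by sign. -/
theorem sum_norm_dual_le_of_forall_norm_sum_le {v : ι → X} {M : ℝ}
    (h : ∀ A : Finset ι, ‖∑ i ∈ A, v i‖ ≤ M) (φ : StrongDual 𝕜 X) (A : Finset ι) :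
    ∑ i ∈ A, ‖φ (v i)‖ ≤ 4 * M * ‖φ‖ := by
  have hφ : ∀ A : Finset ι, ‖∑ i ∈ A, φ (v i)‖ ≤ ‖φ‖ * M := fun A => by
    rw [← map_sum]
    exact (φ.le_opNorm _).trans (by gcongr; exact h A)
  have hre := sum_abs_le_of_forall_abs_sum_le (x := fun i => RCLike.re (φ (v i)))
    (fun A => by rw [← map_sum]; exact (RCLike.abs_re_le_norm _).trans (hφ A)) A
  have him := sum_abs_le_of_forall_abs_sum_le (x := fun i => RCLike.im (φ (v i)))
    (fun A => by rw [← map_sum]; exact (RCLike.abs_im_le_norm _).trans (hφ A)) A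
  calc ∑ i ∈ A, ‖φ (v i)‖ ≤ ∑ i ∈ A, (|RCLike.re (φ (v i))| + |RCLike.im (φ (v i))|) :=
        Finset.sum_le_sum fun i _ => norm_le_abs_re_add_abs_im _
    _ ≤ _ := by rw [Finset.sum_add_distrib]; linarith

/-- If the finite sums of a family are bounded by `M`, then the family has an upper `c₀`-estimate. -/
theorem norm_sum_smul_le_of_forall_norm_sum_le {v : ι → X} {M : ℝ}
    (h : ∀ A : Finset ι, ‖∑ i ∈ A, v i‖ ≤ M) {a : ι → 𝕜} {A : Finset ι} {η : ℝ} (hη : 0 ≤ η)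
    (ha : ∀ i ∈ A, ‖a i‖ ≤ η) : ‖∑ i ∈ A, a i • v i‖ ≤ 4 * M * η := by
  have hM : 0 ≤ M := (norm_nonneg _).trans (h ∅)
  refine NormedSpace.norm_le_dual_bound 𝕜 _ (by positivity) fun φ => ?_
  calc ‖φ (∑ i ∈ A, a i • v i)‖ ≤ ∑ i ∈ A, ‖φ (a i • v i)‖ := by
        rw [map_sum]; exact norm_sum_le _ _
    _ ≤ ∑ i ∈ A, η * ‖φ (v i)‖ := Finset.sum_le_sum fun i hi => by
        rw [map_smul, norm_smul]
        exact mul_le_mul_of_nonneg_right (ha i hi) (norm_nonneg _)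
    _ = η * ∑ i ∈ A, ‖φ (v i)‖ := (Finset.mul_sum _ _ _).symm
    _ ≤ η * (4 * M * ‖φ‖) := by gcongr; exact sum_norm_dual_le_of_forall_norm_sum_le h φ A
    _ = _ := by ring

/-- A seminormalized unconditional basis with bounded finite sums is equivalent to the unit vector
basis of `c₀(ι)`. -/
theorem UnconditionalSchauderBasis.nonempty_equiv_zeroAtInfty [CompleteSpace X]
    [TopologicalSpace ι] [DiscreteTopology ι] (e : UnconditionalSchauderBasis ι 𝕜 X) {m M : ℝ}
    (hm : 0 < m) (hme : ∀ i, m ≤ ‖e i‖) (hM : ∀ A : Finset ι, ‖∑ i ∈ A, e i‖ ≤ M) :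
    Nonempty (X ≃L[𝕜] C₀(ι, 𝕜)) := by
  classical
  obtain ⟨C, hC⟩ := UnconditionalSchauderBasis.exists_norm_proj_le e
  have hM0 : 0 ≤ M := (norm_nonneg _).trans (hM ∅)
  have hC0 : 0 ≤ C := (norm_nonneg _).trans (hC ∅)
  have hcoord : ∀ x i, ‖e.coord i x‖ ≤ C / m * ‖x‖ := by
    intro x i
    have h1 : ‖e.coord i x • e i‖ ≤ C * ‖x‖ := by
      have := (e.proj {i}).le_of_opNorm_le (hC {i}) x
      simpa using this
    rw [norm_smul] at h1
    rw [div_mul_eq_mul_div, le_div_iff₀ hm]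
    exact (mul_le_mul_of_nonneg_left (hme i) (norm_nonneg _)).trans h1
  have hzero : ∀ x, Tendsto (fun i => e.coord i x) (cocompact ι) (𝓝 0) := by
    intro x
    rw [Filter.cocompact_eq_cofinite]
    have h1 := (e.expansion x).summable.tendsto_cofinite_zero
    refine squeeze_zero_norm (a := fun i => m⁻¹ * ‖e.coord i x • e i‖) (fun i => ?_)
      (by simpa using h1.norm.const_mul m⁻¹)
    rw [norm_smul, inv_mul_eq_div, le_div_iff₀ hm]
    exact mul_le_mul_of_nonneg_left (hme i) (norm_nonneg _)
  let L : X →ₗ[𝕜] C₀(ι, 𝕜) :=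
    { toFun := fun x => ⟨⟨fun i => e.coord i x, continuous_of_discreteTopology⟩, hzero x⟩
      map_add' := fun x y => by ext i; exact map_add (e.coord i) x y
      map_smul' := fun a x => by ext i; exact map_smul (e.coord i) a x }
  let T : X →L[𝕜] C₀(ι, 𝕜) := L.mkContinuous (C / m) fun x =>
    ZeroAtInftyContinuousMap.norm_le_of_forall (by positivity) (hcoord x)
  have hT : ∀ x i, T x i = e.coord i x := fun _ _ => rfl
  refine ⟨ContinuousLinearEquiv.ofBijective T ?_ ?_⟩
  · refine LinearMap.ker_eq_bot'.2 fun x hx => ?_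
    have hx : T x = 0 := hx
    have h1 := e.expansion x
    simp only [← hT, hx, ZeroAtInftyContinuousMap.coe_zero, Pi.zero_apply, zero_smul] at h1
    exact h1.unique hasSum_zero
  · refine LinearMap.range_eq_top.2 fun a => ?_
    have hs : Summable fun i => a i • e i := by
      rw [summable_iff_vanishing_norm]
      intro ε hε
      -- Off the finite set where `‖a i‖` reaches this threshold, the upper estimate gives at most
      -- `4 * M * ε / (4 * M + 1) < ε`.
      have hη : 0 < ε / (4 * M + 1) := by positivity
      refine ⟨(a.finite_le_norm hη).toFinset, fun t ht => ?_⟩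
      refine (norm_sum_smul_le_of_forall_norm_sum_le (a := fun i => a i) hM hη.le
        fun i hi => ?_).trans_lt ?_
      · have := Finset.disjoint_left.1 ht hi
        simp only [Set.Finite.mem_toFinset, Set.mem_ofPred, not_le] at this
        exact this.le
      · rw [mul_div_assoc', div_lt_iff₀ (by positivity)]
        nlinarith
    refine ⟨∑' i, a i • e i, ?_⟩
    ext j
    change e.coord j _ = _
    rw [(e.coord j).map_tsum hs, tsum_eq_single j]
    · simp [e.ortho]
    · intro i hi
      simp [e.ortho, hi.symm]

end Basis

/-! ### Consequences of sub-symmetry. -/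

section Subsymmetric

variable {𝕜 X ι : Type*} [RCLike 𝕜] [NormedAddCommGroup X] [NormedSpace 𝕜 X]

theorem Summable.seriesConverges {v : ℕ → X} (h : Summable v) : SeriesConverges v :=
  ⟨_, h.hasSum.tendsto_sum_nat⟩

theorem SeriesConverges.tendsto_sum_Ico_zero {v : ℕ → X} (h : SeriesConverges v) {p : ℕ → ℕ}
    (hp : StrictMono p) :
    Tendsto (fun j => ∑ i ∈ Finset.Ico (p j) (p (j + 1)), v i) atTop (𝓝 0) := by
  obtain ⟨z, hz⟩ := h
  have h1 := hz.comp hp.tendsto_atTop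
  have h2 := (h1.comp (tendsto_add_atTop_nat 1)).sub h1
  rw [sub_self] at h2
  refine h2.congr fun j => ?_
  exact (Finset.sum_Ico_eq_sub v (hp (Nat.lt_succ_self j)).le).symm

/-- A nonincreasing subsequence would stabilize at its minimum, taking one value infinitely often.
-/
theorem exists_strictMono_comp_of_tendsto_cofinite [LinearOrder ι] [WellFoundedLT ι] {v : ℕ → ι}
    (hv : Tendsto v atTop cofinite) : ∃ φ : ℕ → ℕ, StrictMono φ ∧ StrictMono (v ∘ φ) := by
  obtain ⟨g, hg | hg⟩ := exists_increasing_or_nonincreasing_subseq (· < ·) v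
  · exact ⟨g, g.strictMono, fun m n h => hg m n h⟩
  · exfalso
    obtain ⟨_, ⟨n, rfl⟩, hn⟩ := wellFounded_lt.has_min (Set.range (v ∘ g)) (Set.range_nonempty _)
    have h1 : ∀ᶠ k in atTop, v (g k) ≠ v (g n) :=
      (hv.comp g.strictMono.tendsto_atTop).eventually ((Set.finite_singleton _).compl_mem_cofinite)
    obtain ⟨k, hk, hk'⟩ := (h1.and (eventually_gt_atTop n)).exists
    exact hk (le_antisymm (not_lt.1 (hg n k hk')) (not_lt.1 (hn _ ⟨k, rfl⟩)))

variable [LinearOrder ι] [WellFoundedLT ι] [CompleteSpace X] {e : UnconditionalSchauderBasis ι 𝕜 X}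

/-- Coefficients `‖e (t k)‖⁻¹` would give a geometrically dominated series along `s` but unit terms
along `t`. Passing to sparse subsequences, this yields both bounds on the norms of the basis
vectors. -/
theorem IsSubsymmetric.not_forall_two_pow_mul_norm_le (he : IsSubsymmetric e) {s t : ℕ → ι}
    (hs : StrictMono s) (ht : StrictMono t) : ¬ ∀ k, 2 ^ k * ‖e (s k)‖ ≤ ‖e (t k)‖ := by
  intro h
  have hpos : ∀ k, 0 < ‖e (t k)‖ := fun k => norm_pos_iff.2 (e.basis_ne_zero _)
  have h1 : SeriesConverges fun k => ((‖e (t k)‖⁻¹ : ℝ) : 𝕜) • e (s k) := by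
    refine Summable.seriesConverges (Summable.of_norm_bounded summable_geometric_two fun k => ?_)
    rw [norm_smul, RCLike.norm_ofReal, abs_of_pos (inv_pos.2 (hpos k)), inv_mul_eq_div,
      div_le_iff₀ (hpos k), one_div, inv_pow, inv_mul_eq_div, le_div_iff₀ (by positivity), mul_comm]
    exact h k
  have h2 := ((he s t hs ht _).1 h1).tendsto_sum_Ico_zero strictMono_id
  have h3 := h2.norm
  simp only [id, Nat.Ico_succ_singleton, Finset.sum_singleton, norm_smul, RCLike.norm_ofReal,
    abs_of_pos (inv_pos.2 (hpos _)), inv_mul_cancel₀ (hpos _).ne', norm_zero] at h3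
  exact one_ne_zero (tendsto_nhds_unique tendsto_const_nhds h3)

theorem IsSubsymmetric.exists_norm_le (he : IsSubsymmetric e) : ∃ M, ∀ i, ‖e i‖ ≤ M := by
  by_contra! h
  choose v hv using fun k : ℕ => h k
  have hv' : Tendsto (fun k => ‖e (v k)‖) atTop atTop :=
    tendsto_atTop_mono (fun k => (hv k).le) tendsto_natCast_atTop_atTop
  have hcof : Tendsto v atTop cofinite := by
    refine le_cofinite_iff_eventually_ne.2 fun x => eventually_map.2 ?_
    filter_upwards [hv'.eventually_gt_atTop ‖e x‖] with k hk h
    exact hk.ne' (by rw [h])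
  obtain ⟨φ, hφ, hvφ⟩ := exists_strictMono_comp_of_tendsto_cofinite hcof
  obtain ⟨ψ, hψ, h⟩ := extraction_forall_of_eventually fun n =>
    (hv'.comp hφ.tendsto_atTop).eventually_ge_atTop (2 ^ n * ‖e (v (φ n))‖)
  exact he.not_forall_two_pow_mul_norm_le hvφ (hvφ.comp hψ) h

theorem IsSubsymmetric.exists_le_norm (he : IsSubsymmetric e) : ∃ m > 0, ∀ i, m ≤ ‖e i‖ := by
  by_contra! h
  have hpos : ∀ i, 0 < ‖e i‖ := fun i => norm_pos_iff.2 (e.basis_ne_zero _)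
  choose v hv using fun k : ℕ => h (1 / ((k : ℝ) + 1)) (by positivity)
  have hv' : Tendsto (fun k => ‖e (v k)‖) atTop (𝓝 0) :=
    squeeze_zero (fun _ => norm_nonneg _) (fun k => (hv k).le) tendsto_one_div_add_atTop_nhds_zero_nat
  have hcof : Tendsto v atTop cofinite := by
    refine le_cofinite_iff_eventually_ne.2 fun x => eventually_map.2 ?_
    filter_upwards [hv'.eventually (gt_mem_nhds (hpos x))] with k hk h
    exact hk.ne (by rw [h])
  obtain ⟨φ, hφ, hvφ⟩ := exists_strictMono_comp_of_tendsto_cofinite hcof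
  obtain ⟨ψ, hψ, h⟩ := extraction_forall_of_eventually fun n =>
    ((hv'.comp hφ.tendsto_atTop).eventually
      (gt_mem_nhds (div_pos (hpos (v (φ n))) (pow_pos two_pos n))))
  refine he.not_forall_two_pow_mul_norm_le (hvφ.comp hψ) hvφ fun k => ?_
  have := h k
  rw [lt_div_iff₀ (by positivity)] at this
  rw [mul_comm]
  exact this.le

/-- If in a sub-symmetric basis there are successive finite sets of prescribed sizes whose sums are
uniformly bounded, then the sums over all finite sets are uniformly bounded. -/
theorem IsSubsymmetric.exists_norm_sum_le (he : IsSubsymmetric e) {D : ℝ}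
    (hD : ∀ n : ℕ → ℕ, ∃ A : ℕ → Finset ι, (∀ j, ∀ a ∈ A j, ∀ b ∈ A (j + 1), a < b) ∧
      (∀ j, (A j).card = n j) ∧ ∀ j, ‖∑ i ∈ A j, e i‖ ≤ D) :
    ∃ M, ∀ A : Finset ι, ‖∑ i ∈ A, e i‖ ≤ M := by
  classical
  by_contra! hunb
  obtain ⟨M, hM⟩ := he.exists_norm_le
  obtain ⟨B, hBlt, hB⟩ := exists_successive_finsets hM hunb fun j => 2 ^ j
  have hBne : ∀ j, (B j).Nonempty := fun j => by
    rw [Finset.nonempty_iff_ne_empty]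
    intro h
    have := hB j
    rw [h, Finset.sum_empty, norm_zero] at this
    exact absurd this (not_lt.2 (by positivity))
  obtain ⟨A, hAlt, hcard, hA⟩ := hD fun j => (B j).card
  have hAne : ∀ j, (A j).Nonempty := fun j => by
    rw [← Finset.card_pos, hcard]; exact (hBne j).card_pos
  let p : ℕ → ℕ := fun j => ∑ i ∈ Finset.range j, (B i).card
  have hp : ∀ j, p (j + 1) = p j + (B j).card := fun j => Finset.sum_range_succ _ _
  have hpm : StrictMono p := strictMono_nat_of_lt_succ fun j => by
    rw [hp]; exact Nat.lt_add_of_pos_right (hBne j).card_pos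
  obtain ⟨t, ht, htB⟩ := exists_strictMono_map_Ico_eq hBne hBlt (Finset.sum_range_zero _) hp
  obtain ⟨s, hs, hsA⟩ := exists_strictMono_map_Ico_eq (p := p) hAne hAlt (Finset.sum_range_zero _)
    fun j => by rw [hcard]; exact hp j
  obtain ⟨J, hJ⟩ := strictMono_exists_block hpm (Finset.sum_range_zero _)
  let a : ℕ → 𝕜 := fun i => (2⁻¹ : 𝕜) ^ J i
  have hsum : Summable fun j => (2⁻¹ : 𝕜) ^ j • ∑ i ∈ A j, e i := by
    refine Summable.of_norm_bounded (summable_geometric_two.mul_right D) fun j => ?_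
    rw [norm_smul, norm_pow, norm_inv, RCLike.norm_ofNat, one_div]
    gcongr
    exact hA j
  -- Summing block by block yields only a vector `y`; its unconditional expansion, restricted to the
  -- range of `s`, is the termwise series.
  have hs1 : SeriesConverges fun i => a i • e (s i) := by
    set y := ∑' j, (2⁻¹ : 𝕜) ^ j • ∑ i ∈ A j, e i
    have hy : ∀ i, e.coord (s i) y = a i := by
      intro i
      have hmem : ∀ j, s i ∈ A j ↔ J i = j := fun j => by
        rw [← hsA j, ← hJ i j, hs.injective.mem_finset_image]
      have hc : ∀ j, e.coord (s i) ((2⁻¹ : 𝕜) ^ j • ∑ i ∈ A j, e i)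
          = if J i = j then (2⁻¹ : 𝕜) ^ j else 0 := fun j => by
        have := e.coord_sum (A j) 1 (s i)
        simp only [Pi.one_apply, one_smul] at this
        rw [map_smul, this]
        simp [hmem]
      rw [(e.coord (s i)).map_tsum hsum]
      simp only [hc]
      rw [tsum_eq_single (J i) fun j hj => if_neg hj.symm, if_pos rfl]
    have := ((e.expansion y).summable.comp_injective hs.injective).seriesConverges
    simpa only [Function.comp_def, hy] using this
  -- Along `t` the block sums must tend to `0`, yet the `j`th is `2⁻ʲ` times a vector of norm above
  -- `2 ^ j`.
  have ht1 := (((he s t hs ht a).1 hs1).tendsto_sum_Ico_zero hpm).norm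
  rw [norm_zero] at ht1
  obtain ⟨j, hj⟩ := (ht1.eventually (gt_mem_nhds one_pos)).exists
  have h1 : ∑ i ∈ Finset.Ico (p j) (p (j + 1)), a i • e (t i) = (2⁻¹ : 𝕜) ^ j • ∑ i ∈ B j, e i := by
    rw [← htB j, Finset.sum_image ht.injective.injOn, Finset.smul_sum]
    refine Finset.sum_congr rfl fun i hi => ?_
    simp only [a, (hJ i j).1 hi]
  rw [h1, norm_smul, norm_pow, norm_inv, RCLike.norm_ofNat, inv_pow, inv_mul_eq_div,
    div_lt_one (by positivity)] at hj
  exact absurd hj (not_lt.2 (hB j).le)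

end Subsymmetric

/-! ### Assembly of the main theorem. -/

theorem mainTheorem10 {𝕜 : Type*} [RCLike 𝕜]
    {X : Type*} [NormedAddCommGroup X] [NormedSpace 𝕜 X] [CompleteSpace X]
    {ι : Type u} [LinearOrder ι] [WellFoundedLT ι]
    (e : UnconditionalSchauderBasis ι 𝕜 X) (he : IsSubsymmetric e)
    (hdens : ℵ_ Ordinal.omega0 ≤ dens X)
    {Γ : Type*} [TopologicalSpace Γ] [DiscreteTopology Γ]
    (f : X → C₀(Γ, 𝕜)) (hf : IsCoarseEmbedding f ∨ IsUniformEmbedding f) :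
    ∃ (Λ : Type u) (_ : TopologicalSpace Λ) (_ : DiscreteTopology Λ),
      Nonempty (X ≃L[𝕜] C₀(Λ, 𝕜)) := by
  obtain ⟨β, hβ, hβcard⟩ :=
    exists_strictMono_mk_Iio_eq_aleph (aleph_omega_le_mk_of_le_dens e hdens)
  obtain ⟨c, r, D, hr, hD, hfin, hbdd⟩ := exists_colouring hf
  obtain ⟨M, hM⟩ := he.exists_norm_le
  obtain ⟨m, hm, hme⟩ := he.exists_le_norm
  obtain ⟨C, hC⟩ := UnconditionalSchauderBasis.exists_norm_proj_le e
  have hC0 : 0 ≤ C := (norm_nonneg _).trans (hC ∅)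
  have hM0 : 0 < M := (hm.trans_le (hme (β 0))).trans_le (hM (β 0))
  -- Basis vectors are at most `2 * M` apart, so scaling by `τ` brings them within `r`.
  set τ : ℝ := r / (2 * M) with hτ
  have hτ0 : 0 < τ := by positivity
  have hu : ∀ a b, ‖(τ : 𝕜) • e a - (τ : 𝕜) • e b‖ ≤ r := fun a b => by
    rw [← smul_sub, norm_smul, RCLike.norm_ofReal, abs_of_pos hτ0, hτ, div_mul_eq_mul_div,
      div_le_iff₀ (by positivity)]
    gcongr
    linarith [norm_sub_le (e a) (e b), hM a, hM b]
  have key : ∀ k n : ℕ, ∃ A : Finset ι, (∀ a ∈ A, a ∈ Set.Ico (β k) (β (k + n))) ∧ A.card = n ∧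
      ‖∑ i ∈ A, e i‖ ≤ C * (D / τ) := by
    intro k n
    obtain ⟨A, B, hA, -, hcard, hdisj, heq⟩ :=
      exists_disjoint_sum_same_color hu hβ hβcard k n c hfin
    refine ⟨A, hA, hcard, (e.norm_sum_le_of_disjoint hC hdisj).trans ?_⟩
    gcongr
    have := hbdd _ _ heq
    rw [dist_eq_norm, ← Finset.smul_sum, ← Finset.smul_sum, ← smul_sub, norm_smul,
      RCLike.norm_ofReal, abs_of_pos hτ0] at this
    rwa [le_div_iff₀ hτ0, mul_comm]
  obtain ⟨M', hM'⟩ := he.exists_norm_sum_le (D := C * (D / τ)) fun n => by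
    -- Starting at the partial sums of `n` makes the index intervals abut, so the sets are
    -- successive.
    choose A hA using fun j => key (∑ i ∈ Finset.range j, n i) (n j)
    refine ⟨A, fun j a ha b hb => ?_, fun j => (hA j).2.1, fun j => (hA j).2.2⟩
    have h1 := ((hA j).1 a ha).2
    rw [← Finset.sum_range_succ] at h1
    exact h1.trans_le ((hA (j + 1)).1 b hb).1
  let _ : TopologicalSpace ι := ⊥
  have : DiscreteTopology ι := ⟨rfl⟩
  exact ⟨ι, inferInstance, inferInstance, e.nonempty_equiv_zeroAtInfty hm hme hM'⟩
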